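/- Let $n\ge 1$ and $\sigma\ge 1$ be integers, and let $a_0\in C^2(\mathbb R^n;\mathbb C)$ and $\phi_0\in C^2(\mathbb R^n;\mathbb R)$ have compact support, with $(a_0,\phi_0)\neq(0,0)$. Consider the Cauchy problem $$\partial_t\phi+\tfrac12|\nabla\phi|^2+|a|^{2\sigma}=0,\quad \phi_{|t=0}=\phi_0;\qquad \partial_t a+\nabla\phi\cdot\nabla a+\tfrac12\,a\,\Delta\phi=0,\quad a_{|t=0}=a_0,$$ for a complex-valued $a$ and a real-valued $\phi$. Then there is no solution $(a,\phi)\in C^2([0,+\infty[\times\mathbb R^n)$. Moreover the lifespan is finite: the supremum of all $T>0$ for which there is a solution $(a,\phi)\in C^2([0,T[\times\mathbb R^n)$ is finite; in particular, if in addition $a_0$ and $\phi_0$ are $C^\infty$ (so that they lie in $H^\infty(\mathbb R^n)=\bigcap_{s>0}H^s(\mathbb R^n)$), the lifespan $T^*$ of the maximal solution $(\phi,a)\in C([0,T^*[;H^\infty(\mathbb R^n))$ is finite. -/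

import Mathlib

open Set Filter Topology MeasureTheory
open scoped ContDiff

noncomputable section

/-- `(a, φ)` is of class `C²` on `I × ℝⁿ` (`I` a time interval starting at `0`) and solves there the
Cauchy problem
`∂ₜφ + ½|∇φ|² + |a|^{2σ} = 0`, `φ(0) = φ₀`, `∂ₜa + ∇φ·∇a + ½ a Δφ = 0`, `a(0) = a₀`.
The amplitude `a` is complex valued, the phase `φ` is real valued. On `I`, which contains `0`,
the regularity is up to the boundary, and the time derivative at `t = 0` is one-sided. -/
structure IsC2Solution {n : ℕ} (σ : ℕ) (I : Set ℝ)
    (a₀ : EuclideanSpace ℝ (Fin n) → ℂ) (φ₀ : EuclideanSpace ℝ (Fin n) → ℝ)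
    (a : ℝ → EuclideanSpace ℝ (Fin n) → ℂ) (φ : ℝ → EuclideanSpace ℝ (Fin n) → ℝ) : Prop where
  contDiffOn_a : ContDiffOn ℝ 2 (fun p : ℝ × EuclideanSpace ℝ (Fin n) => a p.1 p.2) (I ×ˢ univ)
  contDiffOn_φ : ContDiffOn ℝ 2 (fun p : ℝ × EuclideanSpace ℝ (Fin n) => φ p.1 p.2) (I ×ˢ univ)
  eikonal : ∀ t ∈ I, ∀ x,
    derivWithin (fun s => φ s x) I t + (1 / 2 : ℝ) * ‖gradient (φ t) x‖ ^ 2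
      + ‖a t x‖ ^ (2 * σ) = 0
  transport : ∀ t ∈ I, ∀ x,
    derivWithin (fun s => a s x) I t + fderiv ℝ (a t) x (gradient (φ t) x)
      + (1 / 2 : ℂ) * a t x * ((Laplacian.laplacian (φ t) x : ℝ) : ℂ) = 0
  init_a : ∀ x, a 0 x = a₀ x
  init_φ : ∀ x, φ 0 x = φ₀ x

/-- The lifespan of the Cauchy problem in the class of `C²` solutions: the supremum of all `T > 0`
such that a `C²` solution exists on `[0,T[ × ℝⁿ`. -/
def classicalLifespan {n : ℕ} (σ : ℕ)
    (a₀ : EuclideanSpace ℝ (Fin n) → ℂ) (φ₀ : EuclideanSpace ℝ (Fin n) → ℝ) : ENNReal :=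
  ⨆ T ∈ {T : ℝ | 0 < T ∧ ∃ a φ, IsC2Solution σ (Ico 0 T) a₀ φ₀ a φ}, ENNReal.ofReal T

/-- `f ∈ H^∞(ℝⁿ)`: the (smooth representative) function `f` is square integrable with all its
derivatives. -/
def MemHInfty {n : ℕ} {F : Type*} [NormedAddCommGroup F] [NormedSpace ℝ F]
    (f : EuclideanSpace ℝ (Fin n) → F) : Prop :=
  ContDiff ℝ ∞ f ∧ ∀ k : ℕ, MemLp (iteratedFDeriv ℝ k f) 2 volume

/-- `f ∈ C(I; H^∞(ℝⁿ))`: `f` takes its values in `H^∞` and is continuous for each of the seminorms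
`‖∇ᵏ ·‖_{L²}`, that is, for each `H^s` norm. -/
def ContinuousOnHInfty {n : ℕ} {F : Type*} [NormedAddCommGroup F] [NormedSpace ℝ F]
    (f : ℝ → EuclideanSpace ℝ (Fin n) → F) (I : Set ℝ) : Prop :=
  (∀ t ∈ I, MemHInfty (f t)) ∧
    ∀ k : ℕ, ∀ t ∈ I,
      Tendsto (fun s => eLpNorm (iteratedFDeriv ℝ k (fun x => f s x - f t x)) 2 volume)
        (𝓝[I] t) (𝓝 0)

/-- The lifespan of the Cauchy problem in `H^∞`: the supremum of all `T > 0` such that a solution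
exists in `C([0,T[; H^∞(ℝⁿ))`. (Such solutions are automatically classical, the equations giving
the time regularity.) -/
def sobolevLifespan {n : ℕ} (σ : ℕ)
    (a₀ : EuclideanSpace ℝ (Fin n) → ℂ) (φ₀ : EuclideanSpace ℝ (Fin n) → ℝ) : ENNReal :=
  ⨆ T ∈ {T : ℝ | 0 < T ∧ ∃ a φ, IsC2Solution σ (Ico 0 T) a₀ φ₀ a φ ∧
    ContinuousOnHInfty a (Ico 0 T) ∧ ContinuousOnHInfty φ (Ico 0 T)}, ENNReal.ofReal T

end
/-!
At a fixed point `x` with `a₀ x = 0` and `∇φ₀ x = 0`, the pair `(a, ∇φ)(t, x)` satisfies a linear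
differential inequality in `t`, so by Gronwall it stays zero and `φ(t, x)` stays equal to `φ₀ x`. In
particular the supports never leave those of the data. Moreover `∂ₜφ + ½|∇φ|² ≤ 0`, and integrating
along straight lines gives the Hopf–Lax bound `φ(t, y) ≤ φ(s, x) + |y - x|² / (2(t - s))`.

If `a₀ = 0`, both an extremum of `φ₀` and a point outside its support keep their value of `φ`
forever, while the Hopf–Lax bound forces the difference of these values to be `O(1 / t)`.

If `a₀ ≠ 0`, the mass `∫ |a|²` is conserved and lives in a fixed compact set, so by Jensen's
inequality `∫ |a|^{2σ}` is bounded below and `∫ φ` decreases at least linearly. But the Hopf–Lax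
bound on a unit time interval, with end point `y` outside the supports (where `φ = 0`), bounds `φ`
from below on the supports.
-/


section SpaceTimeCalculus

variable {E F P : Type*} [NormedAddCommGroup E] [NormedSpace ℝ E] [NormedAddCommGroup F]
  [NormedSpace ℝ F] [NormedAddCommGroup P] [NormedSpace ℝ P]

theorem contDiff_slice {f : P → E → F} {s : Set P} {k : WithTop ℕ∞}
    (hf : ContDiffOn ℝ k (fun p : P × E => f p.1 p.2) (s ×ˢ univ)) {t : P} (ht : t ∈ s) :
    ContDiff ℝ k (f t) :=
  hf.comp_contDiff (f := fun x : E => (t, x)) (by fun_prop) fun _ => ⟨ht, mem_univ _⟩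

theorem contDiffOn_fderiv_slice {f : P → E → F} {s : Set P} {k m : WithTop ℕ∞}
    (hf : ContDiffOn ℝ k (fun p : P × E => f p.1 p.2) (s ×ˢ univ)) (hmk : m + 1 ≤ k) :
    ContDiffOn ℝ m (fun p : P × E => fderiv ℝ (f p.1) p.2) (s ×ˢ univ) := by
  intro p hp
  simp only [← fderivWithin_univ]
  refine ContDiffWithinAt.fderivWithin (f := fun q : P × E => f q.1) (g := Prod.snd) ?_
    contDiffWithinAt_snd uniqueDiffOn_univ hmk hp (subset_univ _)
  exact (hf p hp).comp (p, p.2) (g := fun p : P × E => f p.1 p.2)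
    (f := fun q : (P × E) × E => (q.1.1, q.2)) (by fun_prop) fun q hq => ⟨hq.1.1, mem_univ _⟩

theorem hasFDerivAt_slice_right {g : P × E → F} {g' : P × E →L[ℝ] F} {s : Set P} {t : P}
    {x : E} (hg : HasFDerivWithinAt g g' (s ×ˢ univ) (t, x)) (ht : t ∈ s) :
    HasFDerivAt (fun y => g (t, y)) (g' ∘L .inr ℝ P E) x :=
  HasFDerivWithinAt.comp_hasFDerivAt x hg (hasFDerivAt_prodMk_right t x)
    (.of_forall fun _ => ⟨ht, mem_univ _⟩)

theorem hasDerivWithinAt_slice_left {g : ℝ × E → F} {g' : ℝ × E →L[ℝ] F} {I : Set ℝ} {t : ℝ}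
    {x : E} (hg : HasFDerivWithinAt g g' (I ×ˢ univ) (t, x)) :
    HasDerivWithinAt (fun s => g (s, x)) (g' (1, 0)) I t :=
  HasFDerivWithinAt.comp_hasDerivWithinAt (f := fun s : ℝ => (s, x)) t hg
    ((hasDerivWithinAt_id t I).prodMk (hasDerivWithinAt_const t I x))
    fun _ hs => ⟨hs, mem_univ _⟩

theorem hasDerivWithinAt_fderiv_slice {f : ℝ → E → F} {I : Set ℝ} (hI : UniqueDiffOn ℝ I)
    (hI' : I ⊆ closure (interior I))
    (hf : ContDiffOn ℝ 2 (fun p : ℝ × E => f p.1 p.2) (I ×ˢ univ)) {t : ℝ} (ht : t ∈ I) (x : E) :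
    HasDerivWithinAt (fun s => fderiv ℝ (f s) x)
      (fderiv ℝ (fun y => derivWithin (fun s => f s y) I t) x) I t := by
  let g : ℝ × E → F := fun p => f p.1 p.2
  let D : ℝ × E → ℝ × E →L[ℝ] F := fderivWithin ℝ g (I ×ˢ univ)
  let D' : ℝ × E →L[ℝ] ℝ × E →L[ℝ] F := fderivWithin ℝ D (I ×ˢ univ) (t, x)
  have hS : UniqueDiffOn ℝ (I ×ˢ (univ : Set E)) := hI.prod uniqueDiffOn_univ
  have hD {s : ℝ} (hs : s ∈ I) (y : E) : HasFDerivWithinAt g (D (s, y)) (I ×ˢ univ) (s, y) :=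
    (hf.differentiableOn two_ne_zero (s, y) ⟨hs, mem_univ y⟩).hasFDerivWithinAt
  have hD' : HasFDerivWithinAt D D' (I ×ˢ univ) (t, x) :=
    ((hf.fderivWithin hS (m := 1) (by norm_num)).differentiableOn one_ne_zero
      (t, x) ⟨ht, mem_univ x⟩).hasFDerivWithinAt
  have hsymm (v : E) : D' (0, v) (1, 0) = D' (1, 0) (0, v) := by
    have hmem : (t, x) ∈ closure (interior (I ×ˢ (univ : Set E))) := by
      rw [interior_prod_eq, interior_univ, closure_prod_eq, closure_univ]
      exact ⟨hI' ht, mem_univ x⟩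
    exact (hf (t, x) ⟨ht, mem_univ x⟩).isSymmSndFDerivWithinAt (by simp) hS hmem
      ⟨ht, mem_univ x⟩ (0, v) (1, 0)
  have htime : (fun y => derivWithin (fun s => f s y) I t) = fun y => D (t, y) (1, 0) :=
    funext fun y => (hasDerivWithinAt_slice_left (hD ht y)).derivWithin (hI t ht)
  have hspace {s : ℝ} (hs : s ∈ I) : fderiv ℝ (f s) x = D (s, x) ∘L .inr ℝ ℝ E :=
    (hasFDerivAt_slice_right (hD hs x) hs).fderiv
  have hmixed : fderiv ℝ (fun y => D (t, y) (1, 0)) x = D' (1, 0) ∘L .inr ℝ ℝ E := by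
    refine ((hasFDerivAt_slice_right hD' ht).clm_apply
      (hasFDerivAt_const ((1, 0) : ℝ × E) x)).fderiv.trans ?_
    ext v
    simpa using hsymm v
  rw [htime, hmixed]
  refine HasDerivWithinAt.congr_of_mem ?_ (fun s hs => hspace hs) ht
  simpa using (hasDerivWithinAt_slice_left hD').clm_comp
    (hasDerivWithinAt_const t I (ContinuousLinearMap.inr ℝ ℝ E))

theorem fderiv_one_apply_eq_deriv_add_fderiv {g : ℝ × E → F} {t : ℝ} {x : E}
    (hg : DifferentiableAt ℝ g (t, x)) (v : E) :
    fderiv ℝ g (t, x) (1, v)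
      = deriv (fun s => g (s, x)) t + fderiv ℝ (fun y => g (t, y)) x v := by
  have hg' : HasFDerivWithinAt g (fderiv ℝ g (t, x)) (univ ×ˢ univ) (t, x) :=
    hg.hasFDerivAt.hasFDerivWithinAt
  rw [(hasDerivWithinAt_univ.1 (hasDerivWithinAt_slice_left hg')).deriv,
    (hasFDerivAt_slice_right hg' (mem_univ t)).fderiv, ContinuousLinearMap.comp_apply, ← map_add]
  simp

theorem hamiltonJacobi_subsolution_le {φ : ℝ → E → ℝ} {s t : ℝ} (hst : s < t)
    (hc : ContinuousOn (fun p : ℝ × E => φ p.1 p.2) (Icc s t ×ˢ univ))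
    (hd : ∀ r ∈ Ioo s t, ∀ z, DifferentiableAt ℝ (fun p : ℝ × E => φ p.1 p.2) (r, z))
    (hle : ∀ r ∈ Ioo s t, ∀ z, deriv (fun r => φ r z) r + 1 / 2 * ‖fderiv ℝ (φ r) z‖ ^ 2 ≤ 0)
    (x y : E) : φ t y ≤ φ s x + ‖y - x‖ ^ 2 / (2 * (t - s)) := by
  let v : E := (t - s)⁻¹ • (y - x)
  let g : ℝ × E → ℝ := fun p => φ p.1 p.2
  let γ : ℝ → ℝ × E := fun r => (r, x + (r - s) • v)
  have hts : 0 < t - s := sub_pos.2 hst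
  have hγ (r : ℝ) : HasDerivAt γ (1, v) r := by
    have h := (((hasDerivAt_id r).sub_const s).smul_const v).const_add x
    rw [one_smul] at h
    exact (hasDerivAt_id r).prodMk h
  have hgγ {r : ℝ} (hr : r ∈ Ioo s t) : HasDerivAt (g ∘ γ) (fderiv ℝ g (γ r) (1, v)) r :=
    (hd r hr _).hasFDerivAt.comp_hasDerivAt r (hγ r)
  -- Along the segment, `∂ᵣφ + Dφ v ≤ Dφ v - ‖Dφ‖² / 2 ≤ ‖v‖² / 2`.
  have hbound {r : ℝ} (hr : r ∈ Ioo s t) : fderiv ℝ g (γ r) (1, v) ≤ ‖v‖ ^ 2 / 2 := by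
    rw [fderiv_one_apply_eq_deriv_add_fderiv (hd r hr _)]
    have hop := (Real.le_norm_self _).trans ((fderiv ℝ (φ r) (x + (r - s) • v)).le_opNorm v)
    nlinarith [hle r hr (x + (r - s) • v), hop,
      sq_nonneg (‖fderiv ℝ (φ r) (x + (r - s) • v)‖ - ‖v‖)]
  have hmvt := (convex_Icc s t).image_sub_le_mul_sub_of_deriv_le (f := g ∘ γ) (C := ‖v‖ ^ 2 / 2)
    (hc.comp (by fun_prop) fun r hr => ⟨hr, mem_univ _⟩)
    (by rw [interior_Icc]; exact fun r hr => (hgγ hr).differentiableAt.differentiableWithinAt)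
    (by rw [interior_Icc]; exact fun r hr => (hgγ hr).deriv.trans_le (hbound hr))
    s (left_mem_Icc.2 hst.le) t (right_mem_Icc.2 hst.le) hst.le
  have hγt : x + (t - s) • v = y := by simp [v, smul_smul, hts.ne']
  have hv : ‖v‖ ^ 2 / 2 * (t - s) = ‖y - x‖ ^ 2 / (2 * (t - s)) := by
    simp only [v, norm_smul, norm_inv, Real.norm_of_nonneg hts.le]
    field_simp
  simp only [g, γ, Function.comp_apply, hγt, hv, sub_self, zero_smul, add_zero] at hmvt
  linarith

end SpaceTimeCalculus

section GradientLaplacian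

variable {E F : Type*} [NormedAddCommGroup E] [InnerProductSpace ℝ E] [NormedAddCommGroup F]
  [InnerProductSpace ℝ F]

theorem differentiableAt_norm_pow {f : E → F} {x : E} (hf : DifferentiableAt ℝ f x) (m : ℕ) :
    DifferentiableAt ℝ (fun y => ‖f y‖ ^ (2 * m)) x := by
  simpa only [pow_mul] using (hf.norm_sq ℝ).fun_pow m

theorem norm_fderiv_norm_pow_le {f : E → F} {x : E} (hf : DifferentiableAt ℝ f x) (m : ℕ) :
    ‖fderiv ℝ (fun y => ‖f y‖ ^ (2 * m)) x‖ ≤ 2 * m * ‖f x‖ ^ (2 * m - 1) * ‖fderiv ℝ f x‖ := by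
  rcases m with _ | m
  · simp
  have hpow : HasFDerivAt (fun y => ‖f y‖ ^ (2 * (m + 1)))
      (((m + 1 : ℕ) * (‖f x‖ ^ 2) ^ m) • 2 • (innerSL ℝ (f x)).comp (fderiv ℝ f x)) x := by
    simpa [pow_mul] using! hf.hasFDerivAt.norm_sq.pow (m + 1)
  have hcomp : ‖(innerSL ℝ (f x)).comp (fderiv ℝ f x)‖ ≤ ‖f x‖ * ‖fderiv ℝ f x‖ :=
    (ContinuousLinearMap.opNorm_comp_le _ _).trans_eq (by rw [innerSL_apply_norm])
  calc ‖fderiv ℝ (fun y => ‖f y‖ ^ (2 * (m + 1))) x‖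
      = (m + 1 : ℕ) * (‖f x‖ ^ 2) ^ m * (2 * ‖(innerSL ℝ (f x)).comp (fderiv ℝ f x)‖) := by
        rw [hpow.fderiv, norm_smul, ← Nat.cast_smul_eq_nsmul ℝ, norm_smul,
          Real.norm_of_nonneg (by positivity)]
        simp
    _ ≤ (m + 1 : ℕ) * (‖f x‖ ^ 2) ^ m * (2 * (‖f x‖ * ‖fderiv ℝ f x‖)) := by gcongr
    _ = 2 * (m + 1 : ℕ) * ‖f x‖ ^ (2 * (m + 1) - 1) * ‖fderiv ℝ f x‖ := by
        rw [show 2 * (m + 1) - 1 = 2 * m + 1 by omega]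
        ring

theorem norm_gradient_eq_norm_fderiv [CompleteSpace E] (φ : E → ℝ) (x : E) :
    ‖gradient φ x‖ = ‖fderiv ℝ φ x‖ :=
  LinearIsometryEquiv.norm_map _ _

variable [FiniteDimensional ℝ E]

theorem laplacian_eq_sum_fderiv_fderiv (φ : E → ℝ) (x : E) :
    Laplacian.laplacian φ x = ∑ i, fderiv ℝ (fderiv ℝ φ) x (stdOrthonormalBasis ℝ E i)
      (stdOrthonormalBasis ℝ E i) := by
  rw [InnerProductSpace.laplacian_eq_iteratedFDeriv_stdOrthonormalBasis]
  simp [iteratedFDeriv_two_apply]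

theorem gradient_eq_sum_fderiv_smul (φ : E → ℝ) (x : E) :
    gradient φ x = ∑ i, fderiv ℝ φ x (stdOrthonormalBasis ℝ E i) • stdOrthonormalBasis ℝ E i := by
  rw [← (stdOrthonormalBasis ℝ E).sum_repr' (gradient φ x)]
  simp only [real_inner_comm, inner_gradient_left]

variable {P : Type*} [NormedAddCommGroup P] [NormedSpace ℝ P] {s : Set P} {φ : P → E → ℝ}

theorem contDiffOn_gradient_slice
    (hφ : ContDiffOn ℝ 2 (fun p : P × E => φ p.1 p.2) (s ×ˢ univ)) :
    ContDiffOn ℝ 1 (fun p : P × E => gradient (φ p.1) p.2) (s ×ˢ univ) := by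
  simp only [gradient_eq_sum_fderiv_smul]
  exact .sum fun i _ => ((contDiffOn_fderiv_slice hφ (by norm_num)).clm_apply
    contDiffOn_const).smul contDiffOn_const

theorem continuousOn_laplacian_slice
    (hφ : ContDiffOn ℝ 2 (fun p : P × E => φ p.1 p.2) (s ×ˢ univ)) :
    ContinuousOn (fun p : P × E => Laplacian.laplacian (φ p.1) p.2) (s ×ˢ univ) := by
  have hDφ := contDiffOn_fderiv_slice hφ (m := 1) (by norm_num)
  simp only [laplacian_eq_sum_fderiv_fderiv]
  exact continuousOn_finsetSum _ fun i _ =>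
    ((contDiffOn_fderiv_slice (f := fun t => fderiv ℝ (φ t)) hDφ (m := 0) (by simp)).continuousOn
      |>.clm_apply continuousOn_const).clm_apply continuousOn_const

variable [MeasurableSpace E] [BorelSpace E]

theorem integral_fderiv_apply_eq_zero {f : E → ℝ} (hf : ContDiff ℝ 1 f)
    (hc : HasCompactSupport f) (v : E) : ∫ x, fderiv ℝ f x v = 0 := by
  have hint : Integrable fun x => fderiv ℝ f x v :=
    ((hf.continuous_fderiv one_ne_zero).clm_apply continuous_const).integrable_of_hasCompactSupport
      (hc.fderiv_apply ℝ v)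
  simpa using integral_mul_fderiv_eq_neg_fderiv_mul_of_integrable (μ := volume)
    (f := fun _ : E => (1 : ℝ)) (g := f) (v := v) (by simp) (by simpa using hint)
    (by simpa using hf.continuous.integrable_of_hasCompactSupport hc)
    (fun x _ => differentiableAt_const _) (fun x _ => hf.differentiable one_ne_zero x)

theorem integral_fderiv_gradient_add_mul_laplacian {ρ φ : E → ℝ} (hρ : ContDiff ℝ 1 ρ)
    (hc : HasCompactSupport ρ) (hφ : ContDiff ℝ 2 φ) :
    ∫ x, (fderiv ℝ ρ x (gradient φ x) + ρ x * Laplacian.laplacian φ x) = 0 := by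
  let e := stdOrthonormalBasis ℝ E
  have hDφ : ContDiff ℝ 1 (fderiv ℝ φ) := hφ.fderiv_right (by norm_num)
  have hflux (i) : ContDiff ℝ 1 fun x => ρ x * fderiv ℝ φ x (e i) :=
    hρ.mul (hDφ.clm_apply contDiff_const)
  have hfluxc (i) : HasCompactSupport fun x => ρ x * fderiv ℝ φ x (e i) := hc.mul_right
  have hdiv (x : E) : fderiv ℝ ρ x (gradient φ x) + ρ x * Laplacian.laplacian φ x
      = ∑ i, fderiv ℝ (fun x => ρ x * fderiv ℝ φ x (e i)) x (e i) := by
    rw [gradient_eq_sum_fderiv_smul, laplacian_eq_sum_fderiv_fderiv, map_sum, Finset.mul_sum,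
      ← Finset.sum_add_distrib]
    refine Finset.sum_congr rfl fun i _ => ?_
    have hprod := ((hρ.differentiable one_ne_zero x).hasFDerivAt.fun_mul
      ((hDφ.differentiable one_ne_zero x).hasFDerivAt.clm_apply
        (hasFDerivAt_const (e i) x))).fderiv
    rw [hprod]
    simp only [map_smul, smul_eq_mul, add_apply, smul_apply, ContinuousLinearMap.flip_apply,
      ContinuousLinearMap.comp_zero, zero_add, e]
    ring
  simp_rw [hdiv]
  rw [integral_finsetSum _ fun i _ =>
    (((hflux i).continuous_fderiv one_ne_zero).clm_apply
      continuous_const).integrable_of_hasCompactSupport ((hfluxc i).fderiv_apply ℝ _)]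
  exact Finset.sum_eq_zero fun i _ => integral_fderiv_apply_eq_zero (hflux i) (hfluxc i) _

end GradientLaplacian

section Integrals

variable {X F : Type*} [TopologicalSpace X] [MeasurableSpace X] [OpensMeasurableSpace X]
  {μ : Measure X} [IsFiniteMeasureOnCompacts μ]

theorem integral_norm_sq_pos [NormedAddCommGroup F] [μ.IsOpenPosMeasure] {f : X → F}
    (hf : Continuous f) (hc : HasCompactSupport f) (hne : f ≠ 0) : 0 < ∫ x, ‖f x‖ ^ 2 ∂μ := by
  obtain ⟨z, hz⟩ := Function.ne_iff.1 hne
  have hsq : HasCompactSupport fun x => ‖f x‖ ^ 2 :=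
    hc.comp_left (g := fun w => ‖w‖ ^ 2) (by simp)
  exact (hf.norm.pow 2).integral_pos_of_hasCompactSupport_nonneg_nonzero hsq
    (fun x => sq_nonneg _) (pow_ne_zero 2 (norm_ne_zero_iff.2 hz))

variable [T2Space X] {K : Set X}

theorem hasDerivAt_integral_of_compact_support [NormedAddCommGroup F] [NormedSpace ℝ F]
    [SecondCountableTopologyEither X F] {f f' : ℝ → X → F} {U : Set ℝ} (hU : IsOpen U)
    (hK : IsCompact K) (hf : ∀ t ∈ U, Continuous (f t))
    (hf' : ContinuousOn (fun p : ℝ × X => f' p.1 p.2) (U ×ˢ univ))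
    (hderiv : ∀ t ∈ U, ∀ x, HasDerivAt (fun s => f s x) (f' t x) t)
    (hzero : ∀ t ∈ U, ∀ x ∉ K, f t x = 0) {t : ℝ} (ht : t ∈ U) :
    HasDerivAt (fun s => ∫ x, f s x ∂μ) (∫ x, f' t x ∂μ) t := by
  obtain ⟨ε, hε, hεU⟩ := Metric.nhds_basis_closedBall.mem_iff.1 (hU.mem_nhds ht)
  obtain ⟨C, hC⟩ := ((isCompact_closedBall t ε).prod hK).exists_bound_of_continuousOn
    (hf'.mono (prod_mono hεU (subset_univ K)))
  have hzero' {s : ℝ} (hs : s ∈ U) {x : X} (hx : x ∉ K) : f' s x = 0 := by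
    have hconst : (fun _ : ℝ => (0 : F)) =ᶠ[𝓝 s] fun r => f r x := by
      filter_upwards [hU.mem_nhds hs] with r hr using (hzero r hr x hx).symm
    exact ((hderiv s hs x).congr_of_eventuallyEq hconst).unique (hasDerivAt_const s 0)
  have hbound (x : X) {s : ℝ} (hs : s ∈ Metric.closedBall t ε) :
      ‖f' s x‖ ≤ K.indicator (fun _ => C) x := by
    by_cases hx : x ∈ K
    · simpa only [indicator_of_mem hx] using hC (s, x) ⟨hs, hx⟩
    · simp only [indicator_of_notMem hx, hzero' (hεU hs) hx, norm_zero, le_refl]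
  refine (hasDerivAt_integral_of_dominated_loc_of_deriv_le (Metric.closedBall_mem_nhds t hε)
    ?_ ?_ ?_ (ae_of_all _ fun x s hs => hbound x hs) ?_
    (ae_of_all _ fun x s hs => hderiv s (hεU hs) x)).2
  · filter_upwards [hU.mem_nhds ht] with s hs using (hf s hs).aestronglyMeasurable
  · exact (hf t ht).integrable_of_hasCompactSupport (.intro hK (hzero t ht))
  · exact (hf'.comp_continuous (f := fun x => (t, x)) (by fun_prop)
      fun x => ⟨ht, mem_univ x⟩).aestronglyMeasurable
  · exact (integrable_indicator_iff hK.measurableSet).2 (integrableOn_const hK.measure_lt_top.ne)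

theorem pow_setIntegral_le (hK : IsCompact K) (hK₀ : μ K ≠ 0) {f : X → ℝ} (hf : Continuous f)
    (hf₀ : ∀ x, 0 ≤ f x) (m : ℕ) :
    μ.real K * ((∫ x in K, f x ∂μ) / μ.real K) ^ m ≤ ∫ x in K, f x ^ m ∂μ := by
  have hK₁ : μ K ≠ ⊤ := hK.measure_lt_top.ne
  have hjensen := (convexOn_pow m).map_set_average_le (μ := μ) (t := K) (f := f)
    (by fun_prop) isClosed_Ici hK₀ hK₁ (ae_of_all _ hf₀)
    (hf.continuousOn.integrableOn_compact hK) ((hf.pow m).continuousOn.integrableOn_compact hK)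
  have hpos : 0 < μ.real K := ENNReal.toReal_pos hK₀ hK₁
  simp only [setAverage_eq, smul_eq_mul, ← div_eq_inv_mul] at hjensen
  exact (le_div_iff₀' hpos).1 hjensen

end Integrals

section VacuumAtRest

variable {E : Type*} [NormedAddCommGroup E] [NormedSpace ℝ E]

/-- The point `x` is in vacuum at rest for the state `(a, φ)`: the density `‖a‖ ^ 2` and the
velocity `∇φ` vanish there. The vanishing of `∇φ` is expressed through the Fréchet derivative. -/
def IsVacuumAtRest (a : E → ℂ) (φ : E → ℝ) (x : E) : Prop :=
  a x = 0 ∧ fderiv ℝ φ x = 0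

theorem isVacuumAtRest_of_notMem_tsupport {a : E → ℂ} {φ : E → ℝ} {x : E} (ha : x ∉ tsupport a)
    (hφ : x ∉ tsupport φ) : IsVacuumAtRest a φ x :=
  ⟨image_eq_zero_of_notMem_tsupport ha, fderiv_of_notMem_tsupport ℝ hφ⟩

theorem exists_ne_zero_fderiv_eq_zero {f : E → ℝ} (hf : Continuous f) (hc : HasCompactSupport f)
    (hne : f ≠ 0) : ∃ x, f x ≠ 0 ∧ fderiv ℝ f x = 0 := by
  obtain ⟨x, hx⟩ := hf.norm.exists_forall_ge_of_hasCompactSupport hc.norm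
  obtain ⟨z, hz⟩ := Function.ne_iff.1 hne
  have hfx : f x ≠ 0 := norm_pos_iff.1 ((norm_pos_iff.2 hz).trans_le (hx z))
  refine ⟨x, hfx, ?_⟩
  rcases hfx.lt_or_gt with hneg | hpos
  · have hmin : IsLocalMin f x := .of_forall fun y => by
      simpa [abs_of_neg hneg] using neg_le_neg ((neg_le_abs _).trans (hx y))
    exact hmin.fderiv_eq_zero
  · have hmax : IsLocalMax f x := .of_forall fun y => by
      simpa [abs_of_pos hpos] using (le_abs_self _).trans (hx y)
    exact hmax.fderiv_eq_zero

end VacuumAtRest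

namespace IsC2Solution

variable {n σ : ℕ} {I : Set ℝ} {T t : ℝ} {a₀ : EuclideanSpace ℝ (Fin n) → ℂ}
  {φ₀ : EuclideanSpace ℝ (Fin n) → ℝ} {a : ℝ → EuclideanSpace ℝ (Fin n) → ℂ}
  {φ : ℝ → EuclideanSpace ℝ (Fin n) → ℝ}

theorem contDiff_a (h : IsC2Solution σ I a₀ φ₀ a φ) (ht : t ∈ I) : ContDiff ℝ 2 (a t) :=
  contDiff_slice h.contDiffOn_a ht

theorem contDiff_φ (h : IsC2Solution σ I a₀ φ₀ a φ) (ht : t ∈ I) : ContDiff ℝ 2 (φ t) :=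
  contDiff_slice h.contDiffOn_φ ht

theorem differentiableWithinAt_a (h : IsC2Solution σ I a₀ φ₀ a φ) (ht : t ∈ I)
    (x : EuclideanSpace ℝ (Fin n)) : DifferentiableWithinAt ℝ (fun s => a s x) I t :=
  (hasDerivWithinAt_slice_left (h.contDiffOn_a.differentiableOn two_ne_zero (t, x)
    ⟨ht, mem_univ x⟩).hasFDerivWithinAt).differentiableWithinAt

theorem hasDerivWithinAt_φ (h : IsC2Solution σ I a₀ φ₀ a φ) (ht : t ∈ I)
    (x : EuclideanSpace ℝ (Fin n)) :
    HasDerivWithinAt (fun s => φ s x)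
      (-(1 / 2 * ‖gradient (φ t) x‖ ^ 2 + ‖a t x‖ ^ (2 * σ))) I t := by
  have hdiff : DifferentiableWithinAt ℝ (fun s => φ s x) I t := (hasDerivWithinAt_slice_left
    (h.contDiffOn_φ.differentiableOn two_ne_zero (t, x) ⟨ht, mem_univ x⟩).hasFDerivWithinAt
    ).differentiableWithinAt
  refine hdiff.hasDerivWithinAt.congr_deriv ?_
  linear_combination h.eikonal t ht x

theorem norm_derivWithin_a_le (h : IsC2Solution σ I a₀ φ₀ a φ) (ht : t ∈ I)
    (x : EuclideanSpace ℝ (Fin n)) :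
    ‖derivWithin (fun s => a s x) I t‖ ≤ ‖fderiv ℝ (a t) x‖ * ‖fderiv ℝ (φ t) x‖
      + 1 / 2 * ‖Laplacian.laplacian (φ t) x‖ * ‖a t x‖ := by
  have htransport : derivWithin (fun s => a s x) I t = -(fderiv ℝ (a t) x (gradient (φ t) x)
      + (1 / 2 : ℂ) * Laplacian.laplacian (φ t) x * a t x) := by
    linear_combination h.transport t ht x
  rw [htransport, norm_neg, ← norm_gradient_eq_norm_fderiv]
  refine (norm_add_le _ _).trans (add_le_add ((fderiv ℝ (a t) x).le_opNorm _) ?_)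
  simp

theorem norm_fderiv_derivWithin_φ_le (h : IsC2Solution σ I a₀ φ₀ a φ) (ht : t ∈ I)
    (x : EuclideanSpace ℝ (Fin n)) :
    ‖fderiv ℝ (fun y => derivWithin (fun s => φ s y) I t) x‖
      ≤ ‖fderiv ℝ (gradient (φ t)) x‖ * ‖fderiv ℝ (φ t) x‖
        + 2 * σ * ‖a t x‖ ^ (2 * σ - 1) * ‖fderiv ℝ (a t) x‖ := by
  have heikonal : (fun y => derivWithin (fun s => φ s y) I t)
      = -fun y => 1 / 2 * ‖gradient (φ t) y‖ ^ (2 * 1) + ‖a t y‖ ^ (2 * σ) :=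
    funext fun y => by
      simp only [Pi.neg_apply, mul_one]
      linear_combination h.eikonal t ht y
  have hgrad : DifferentiableAt ℝ (gradient (φ t)) x :=
    (contDiff_slice (f := fun t => gradient (φ t)) (contDiffOn_gradient_slice h.contDiffOn_φ)
      ht).differentiable one_ne_zero x
  have ha : DifferentiableAt ℝ (a t) x := (h.contDiff_a ht).differentiable two_ne_zero x
  have hgrad_le : ‖fderiv ℝ (fun y => 1 / 2 * ‖gradient (φ t) y‖ ^ (2 * 1)) x‖
      ≤ ‖fderiv ℝ (gradient (φ t)) x‖ * ‖fderiv ℝ (φ t) x‖ := by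
    rw [fderiv_const_mul (differentiableAt_norm_pow hgrad 1), norm_smul]
    have hsq := norm_fderiv_norm_pow_le hgrad 1
    simp only [mul_one, Nat.cast_one, Nat.add_one_sub_one, pow_one, norm_gradient_eq_norm_fderiv]
      at hsq ⊢
    rw [Real.norm_of_nonneg (by norm_num : (0 : ℝ) ≤ 1 / 2)]
    linarith
  rw [heikonal, fderiv_neg, norm_neg, fderiv_fun_add
    ((differentiableAt_norm_pow hgrad 1).const_mul _) (differentiableAt_norm_pow ha σ)]
  exact (norm_add_le _ _).trans (add_le_add hgrad_le (norm_fderiv_norm_pow_le ha σ))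

theorem hasDerivWithinAt_fderiv_φ (h : IsC2Solution σ (Ico 0 T) a₀ φ₀ a φ) (ht : t ∈ Ico 0 T)
    (x : EuclideanSpace ℝ (Fin n)) :
    HasDerivWithinAt (fun s => fderiv ℝ (φ s) x)
      (fderiv ℝ (fun y => derivWithin (fun s => φ s y) (Ico 0 T) t) x) (Ico 0 T) t :=
  hasDerivWithinAt_fderiv_slice (uniqueDiffOn_Ico 0 T)
    (by rw [interior_Ico, closure_Ioo (ht.1.trans_lt ht.2).ne]; exact Ico_subset_Icc_self)
    h.contDiffOn_φ ht x

/-- A bound for the rate at which, at a point in vacuum at rest, a disturbance of `(a, ∇φ)` could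
grow: along a solution, `(a, ∇φ)` satisfies a linear differential inequality with this rate at each
fixed point of space. -/
noncomputable def disturbanceRate (σ : ℕ) (a : EuclideanSpace ℝ (Fin n) → ℂ)
    (φ : EuclideanSpace ℝ (Fin n) → ℝ) (x : EuclideanSpace ℝ (Fin n)) : ℝ :=
  ‖fderiv ℝ a x‖ + 1 / 2 * ‖Laplacian.laplacian φ x‖ + ‖fderiv ℝ (gradient φ) x‖
    + 2 * σ * ‖a x‖ ^ (2 * σ - 2) * ‖fderiv ℝ a x‖

theorem continuousOn_disturbanceRate (h : IsC2Solution σ I a₀ φ₀ a φ)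
    (x : EuclideanSpace ℝ (Fin n)) :
    ContinuousOn (fun t => disturbanceRate σ (a t) (φ t) x) I := by
  have hline {F : Type} [TopologicalSpace F] {g : ℝ × EuclideanSpace ℝ (Fin n) → F}
      (hg : ContinuousOn g (I ×ˢ univ)) : ContinuousOn (fun t => g (t, x)) I :=
    hg.comp (by fun_prop) fun t ht => ⟨ht, mem_univ x⟩
  have ha := hline h.contDiffOn_a.continuousOn
  have hDa := hline (contDiffOn_fderiv_slice h.contDiffOn_a (m := 1) (by norm_num)).continuousOn
  have hΔφ := hline (continuousOn_laplacian_slice h.contDiffOn_φ)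
  have hDgrad := hline (contDiffOn_fderiv_slice (f := fun t => gradient (φ t))
    (contDiffOn_gradient_slice h.contDiffOn_φ) (m := 0) (by simp)).continuousOn
  unfold disturbanceRate
  fun_prop

theorem norm_prodMk_derivWithin_le (h : IsC2Solution σ I a₀ φ₀ a φ) (hσ : 1 ≤ σ) (ht : t ∈ I)
    (x : EuclideanSpace ℝ (Fin n)) :
    ‖(derivWithin (fun s => a s x) I t, fderiv ℝ (fun y => derivWithin (fun s => φ s y) I t) x)‖
      ≤ disturbanceRate σ (a t) (φ t) x * ‖(a t x, fderiv ℝ (φ t) x)‖ := by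
  set N := ‖(a t x, fderiv ℝ (φ t) x)‖
  have ha : ‖a t x‖ ≤ N := norm_fst_le (a t x, fderiv ℝ (φ t) x)
  have hφ : ‖fderiv ℝ (φ t) x‖ ≤ N := norm_snd_le (a t x, fderiv ℝ (φ t) x)
  have hpow : ‖a t x‖ ^ (2 * σ - 1) ≤ ‖a t x‖ ^ (2 * σ - 2) * N := by
    rw [show 2 * σ - 1 = 2 * σ - 2 + 1 by omega, pow_succ]
    gcongr
  refine norm_prod_le_iff.2 ⟨(h.norm_derivWithin_a_le ht x).trans ?_,
    (h.norm_fderiv_derivWithin_φ_le ht x).trans ?_⟩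
  · calc _ ≤ ‖fderiv ℝ (a t) x‖ * N + 1 / 2 * ‖Laplacian.laplacian (φ t) x‖ * N := by gcongr
      _ ≤ (‖fderiv ℝ (a t) x‖ * N + 1 / 2 * ‖Laplacian.laplacian (φ t) x‖ * N)
          + (‖fderiv ℝ (gradient (φ t)) x‖
            + 2 * σ * ‖a t x‖ ^ (2 * σ - 2) * ‖fderiv ℝ (a t) x‖) * N :=
        le_add_of_nonneg_right (by positivity)
      _ = _ := by rw [disturbanceRate]; ring
  · calc _ ≤ ‖fderiv ℝ (gradient (φ t)) x‖ * N
          + 2 * σ * (‖a t x‖ ^ (2 * σ - 2) * N) * ‖fderiv ℝ (a t) x‖ := by gcongr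
      _ ≤ (‖fderiv ℝ (a t) x‖ + 1 / 2 * ‖Laplacian.laplacian (φ t) x‖) * N
          + (‖fderiv ℝ (gradient (φ t)) x‖ * N
            + 2 * σ * (‖a t x‖ ^ (2 * σ - 2) * N) * ‖fderiv ℝ (a t) x‖) :=
        le_add_of_nonneg_left (by positivity)
      _ = _ := by rw [disturbanceRate]; ring

theorem isVacuumAtRest (h : IsC2Solution σ (Ico 0 T) a₀ φ₀ a φ) (hσ : 1 ≤ σ)
    {x : EuclideanSpace ℝ (Fin n)} (hx : IsVacuumAtRest a₀ φ₀ x) (ht : t ∈ Ico 0 T) :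
    IsVacuumAtRest (a t) (φ t) x := by
  have hsub : Icc 0 t ⊆ Ico 0 T := Icc_subset_Ico_right ht.2
  obtain ⟨C, hC⟩ := isCompact_Icc.exists_bound_of_continuousOn
    ((h.continuousOn_disturbanceRate x).mono hsub)
  have hderiv {s : ℝ} (hs : s ∈ Ico 0 T) :=
    (h.differentiableWithinAt_a hs x).hasDerivWithinAt.prodMk (h.hasDerivWithinAt_fderiv_φ hs x)
  have hzero : (a 0 x, fderiv ℝ (φ 0) x) = 0 := by
    rw [h.init_a, show φ 0 = φ₀ from funext h.init_φ, hx.1, hx.2, Prod.mk_zero_zero]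
  have hgrowth {s : ℝ} (hs : s ∈ Icc 0 t) :
      ‖(derivWithin (fun r => a r x) (Ico 0 T) s,
        fderiv ℝ (fun y => derivWithin (fun r => φ r y) (Ico 0 T) s) x)‖
          ≤ C * ‖(a s x, fderiv ℝ (φ s) x)‖ :=
    (h.norm_prodMk_derivWithin_le hσ (hsub hs) x).trans
      (mul_le_mul_of_nonneg_right ((le_abs_self _).trans (hC s hs)) (norm_nonneg _))
  have hstate := eq_zero_of_abs_deriv_le_mul_abs_self_of_eq_zero_right
    (fun s hs => (hderiv (hsub hs)).continuousWithinAt.mono hsub)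
    (fun s hs => (hderiv (hsub (Ico_subset_Icc_self hs))).mono_of_mem_nhdsWithin
      (Ico_mem_nhdsGE_of_mem (hsub (Ico_subset_Icc_self hs))))
    hzero (fun s hs => hgrowth (Ico_subset_Icc_self hs)) t (right_mem_Icc.2 ht.1)
  exact Prod.mk_eq_zero.1 hstate

theorem φ_eq_of_isVacuumAtRest (h : IsC2Solution σ (Ico 0 T) a₀ φ₀ a φ) (hσ : 1 ≤ σ)
    {x : EuclideanSpace ℝ (Fin n)} (hx : IsVacuumAtRest a₀ φ₀ x) (ht : t ∈ Ico 0 T) :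
    φ t x = φ₀ x := by
  have hderiv (s : ℝ) (hs : s ∈ Ico 0 T) :
      HasDerivWithinAt (fun s => φ s x) 0 (Ico 0 T) s := by
    obtain ⟨ha, hφ⟩ := h.isVacuumAtRest hσ hx hs
    simpa [norm_gradient_eq_norm_fderiv, ha, hφ, zero_pow (by omega : 2 * σ ≠ 0)] using
      h.hasDerivWithinAt_φ hs x
  have hconst := (convex_Ico 0 T).norm_image_sub_le_of_norm_hasDerivWithin_le hderiv
    (fun s _ => norm_zero.le) ⟨le_rfl, ht.1.trans_lt ht.2⟩ ht
  rw [zero_mul, norm_le_zero_iff, sub_eq_zero] at hconst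
  exact hconst.trans (h.init_φ x)

theorem φ_le_add_norm_sq_div (h : IsC2Solution σ (Ico 0 T) a₀ φ₀ a φ) {s : ℝ} (hs : 0 ≤ s)
    (hst : s < t) (htT : t < T) (x y : EuclideanSpace ℝ (Fin n)) :
    φ t y ≤ φ s x + ‖y - x‖ ^ 2 / (2 * (t - s)) := by
  have hnhds {r : ℝ} (hr : r ∈ Ioo s t) : Ico 0 T ∈ 𝓝 r :=
    Ico_mem_nhds (hs.trans_lt hr.1) (hr.2.trans htT)
  refine hamiltonJacobi_subsolution_le hst
    (h.contDiffOn_φ.continuousOn.mono (prod_mono (fun r hr => ⟨hs.trans hr.1, hr.2.trans_lt htT⟩)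
      subset_rfl)) (fun r hr z => ?_) (fun r hr z => ?_) x y
  · exact (h.contDiffOn_φ.contDiffAt (prod_mem_nhds (hnhds hr) univ_mem)).differentiableAt
      two_ne_zero
  · rw [((h.hasDerivWithinAt_φ (mem_of_mem_nhds (hnhds hr)) z).hasDerivAt (hnhds hr)).deriv,
      ← norm_gradient_eq_norm_fderiv]
    linarith [pow_nonneg (norm_nonneg (a r z)) (2 * σ)]

theorem lifespan_le_of_isVacuumAtRest (h : IsC2Solution σ (Ico 0 T) a₀ φ₀ a φ) (hσ : 1 ≤ σ)
    {x y : EuclideanSpace ℝ (Fin n)} (hx : IsVacuumAtRest a₀ φ₀ x) (hy : IsVacuumAtRest a₀ φ₀ y)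
    (hxy : φ₀ x ≠ φ₀ y) : T ≤ ‖y - x‖ ^ 2 / (2 * |φ₀ y - φ₀ x|) := by
  have hgap : 0 < |φ₀ y - φ₀ x| := abs_pos.2 (sub_ne_zero.2 hxy.symm)
  by_contra! hT
  obtain ⟨t, hbt, htT⟩ := exists_between hT
  have ht : 0 < t := lt_of_le_of_lt (by positivity) hbt
  have hφ {z : EuclideanSpace ℝ (Fin n)} (hz : IsVacuumAtRest a₀ φ₀ z) : φ t z = φ₀ z :=
    h.φ_eq_of_isVacuumAtRest hσ hz ⟨ht.le, htT⟩
  have hxy_le := h.φ_le_add_norm_sq_div le_rfl ht htT x y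
  have hyx_le := h.φ_le_add_norm_sq_div le_rfl ht htT y x
  rw [hφ hy, h.init_φ, sub_zero] at hxy_le
  rw [hφ hx, h.init_φ, sub_zero, norm_sub_rev] at hyx_le
  have hgap_le : |φ₀ y - φ₀ x| ≤ ‖y - x‖ ^ 2 / (2 * t) :=
    abs_sub_le_iff.2 ⟨by linarith, by linarith⟩
  rw [div_lt_iff₀ (by positivity)] at hbt
  rw [le_div_iff₀ (by positivity)] at hgap_le
  linarith

theorem eq_zero_of_notMem_tsupport (h : IsC2Solution σ (Ico 0 T) a₀ φ₀ a φ) (hσ : 1 ≤ σ)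
    {x : EuclideanSpace ℝ (Fin n)} (ha : x ∉ tsupport a₀) (hφ : x ∉ tsupport φ₀)
    (ht : t ∈ Ico 0 T) : a t x = 0 ∧ φ t x = 0 := by
  have hx := isVacuumAtRest_of_notMem_tsupport ha hφ
  exact ⟨(h.isVacuumAtRest hσ hx ht).1,
    (h.φ_eq_of_isVacuumAtRest hσ hx ht).trans (image_eq_zero_of_notMem_tsupport hφ)⟩

section Mass

variable {K : Set (EuclideanSpace ℝ (Fin n))}

theorem hasDerivWithinAt_norm_sq_a (h : IsC2Solution σ I a₀ φ₀ a φ) (ht : t ∈ I)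
    (x : EuclideanSpace ℝ (Fin n)) :
    HasDerivWithinAt (fun s => ‖a s x‖ ^ 2)
      (-(fderiv ℝ (fun y => ‖a t y‖ ^ 2) x (gradient (φ t) x)
        + ‖a t x‖ ^ 2 * Laplacian.laplacian (φ t) x)) I t := by
  have ha : DifferentiableAt ℝ (a t) x := (h.contDiff_a ht).differentiable two_ne_zero x
  have htransport : derivWithin (fun s => a s x) I t = -fderiv ℝ (a t) x (gradient (φ t) x)
      - (1 / 2 * Laplacian.laplacian (φ t) x : ℝ) • a t x := by
    rw [Complex.real_smul]
    push_cast
    linear_combination h.transport t ht x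
  refine (h.differentiableWithinAt_a ht x).hasDerivWithinAt.norm_sq.congr_deriv ?_
  rw [htransport, ha.hasFDerivAt.norm_sq.fderiv, inner_sub_right, inner_neg_right,
    real_inner_smul_right, real_inner_self_eq_norm_sq]
  simp only [smul_apply, nsmul_eq_mul, Nat.cast_ofNat, ContinuousLinearMap.comp_apply,
    innerSL_apply_apply]
  ring

theorem continuousOn_deriv_norm_sq_a (h : IsC2Solution σ I a₀ φ₀ a φ) :
    ContinuousOn (fun p : ℝ × EuclideanSpace ℝ (Fin n) =>
      -(fderiv ℝ (fun y => ‖a p.1 y‖ ^ 2) p.2 (gradient (φ p.1) p.2)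
        + ‖a p.1 p.2‖ ^ 2 * Laplacian.laplacian (φ p.1) p.2)) (I ×ˢ univ) := by
  have hasq := h.contDiffOn_a.norm_sq ℝ
  have hDasq := (contDiffOn_fderiv_slice (f := fun t y => ‖a t y‖ ^ 2) (m := 1) hasq
    (by norm_num)).continuousOn
  have hgrad := (contDiffOn_gradient_slice h.contDiffOn_φ).continuousOn
  exact ((hDasq.clm_apply hgrad).add
    (hasq.continuousOn.mul (continuousOn_laplacian_slice h.contDiffOn_φ))).neg

theorem integral_norm_sq_a_eq (h : IsC2Solution σ (Ico 0 T) a₀ φ₀ a φ) (hσ : 1 ≤ σ)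
    (hK : IsCompact K) (haK : tsupport a₀ ⊆ K) (hφK : tsupport φ₀ ⊆ K) (ht : t ∈ Ico 0 T) :
    ∫ x, ‖a t x‖ ^ 2 = ∫ x, ‖a₀ x‖ ^ 2 := by
  have hzero (s : ℝ) (hs : s ∈ Ico 0 T) (x) (hx : x ∉ K) : ‖a s x‖ ^ 2 = 0 := by
    simp [(h.eq_zero_of_notMem_tsupport hσ (notMem_subset haK hx) (notMem_subset hφK hx) hs).1]
  have hderiv (s : ℝ) (hs : s ∈ Ioo 0 T) : HasDerivAt (fun s => ∫ x, ‖a s x‖ ^ 2) 0 s := by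
    have hs' := Ioo_subset_Ico_self hs
    have hasq : ContDiff ℝ 2 fun x => ‖a s x‖ ^ 2 := (h.contDiff_a hs').norm_sq ℝ
    refine (hasDerivAt_integral_of_compact_support isOpen_Ioo hK
      (fun r hr => ((h.contDiff_a (Ioo_subset_Ico_self hr)).norm_sq ℝ).continuous)
      (h.continuousOn_deriv_norm_sq_a.mono (prod_mono Ioo_subset_Ico_self subset_rfl))
      (fun r hr x => (h.hasDerivWithinAt_norm_sq_a (Ioo_subset_Ico_self hr) x).hasDerivAt
        (Ico_mem_nhds hr.1 hr.2)) (fun r hr => hzero r (Ioo_subset_Ico_self hr)) hs).congr_deriv ?_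
    rw [integral_neg, integral_fderiv_gradient_add_mul_laplacian (hasq.of_le one_le_two)
      (.intro hK (hzero s hs')) (h.contDiff_φ hs'), neg_zero]
  have hcont : ContinuousOn (fun s => ∫ x, ‖a s x‖ ^ 2) (Ico 0 T) :=
    continuousOn_integral_of_compact_support hK (h.contDiffOn_a.norm_sq ℝ).continuousOn
      fun s x hs hx => hzero s hs x hx
  rcases ht.1.eq_or_lt with rfl | ht₀
  · simp only [h.init_a]
  obtain ⟨s, -, hs⟩ := exists_hasDerivAt_eq_slope _ (fun _ => 0) ht₀
    (hcont.mono (Icc_subset_Ico_right ht.2)) fun s hs => hderiv s ⟨hs.1, hs.2.trans ht.2⟩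
  have hconst := (div_eq_zero_iff.1 hs.symm).resolve_right (by linarith)
  simpa only [h.init_a] using sub_eq_zero.1 hconst

theorem le_integral_norm_pow_a (h : IsC2Solution σ (Ico 0 T) a₀ φ₀ a φ) (hσ : 1 ≤ σ)
    (hK : IsCompact K) (hK₀ : volume K ≠ 0) (haK : tsupport a₀ ⊆ K) (hφK : tsupport φ₀ ⊆ K)
    (ht : t ∈ Ico 0 T) :
    volume.real K * ((∫ x, ‖a₀ x‖ ^ 2) / volume.real K) ^ σ ≤ ∫ x, ‖a t x‖ ^ (2 * σ) := by
  have hset (m : ℕ) (hm : m ≠ 0) : ∫ x in K, ‖a t x‖ ^ m = ∫ x, ‖a t x‖ ^ m :=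
    setIntegral_eq_integral_of_forall_compl_eq_zero fun x hx => by
      rw [(h.eq_zero_of_notMem_tsupport hσ (notMem_subset haK hx) (notMem_subset hφK hx) ht).1,
        norm_zero, zero_pow hm]
  have hjensen := pow_setIntegral_le hK hK₀ ((h.contDiff_a ht).norm_sq ℝ).continuous
    (fun x => sq_nonneg _) σ
  simp only [← pow_mul] at hjensen
  rwa [hset 2 two_ne_zero, hset (2 * σ) (by omega), h.integral_norm_sq_a_eq hσ hK haK hφK ht]
    at hjensen

theorem le_integral_kinetic_add_internal (h : IsC2Solution σ (Ico 0 T) a₀ φ₀ a φ) (hσ : 1 ≤ σ)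
    (hK : IsCompact K) (hK₀ : volume K ≠ 0) (haK : tsupport a₀ ⊆ K) (hφK : tsupport φ₀ ⊆ K)
    (ht : t ∈ Ico 0 T) :
    volume.real K * ((∫ x, ‖a₀ x‖ ^ 2) / volume.real K) ^ σ
      ≤ ∫ x, (1 / 2 * ‖gradient (φ t) x‖ ^ 2 + ‖a t x‖ ^ (2 * σ)) := by
  have hrest (x) (hx : x ∉ K) : IsVacuumAtRest (a t) (φ t) x := h.isVacuumAtRest hσ
    (isVacuumAtRest_of_notMem_tsupport (notMem_subset haK hx) (notMem_subset hφK hx)) ht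
  have ha : Continuous (a t) := (h.contDiff_a ht).continuous
  have hgrad : Continuous (gradient (φ t)) := (contDiff_slice (f := fun t => gradient (φ t))
    (contDiffOn_gradient_slice h.contDiffOn_φ) ht).continuous
  have hpow_zero : (0 : ℝ) ^ (2 * σ) = 0 := zero_pow (by omega)
  refine (h.le_integral_norm_pow_a hσ hK hK₀ haK hφK ht).trans (integral_mono ?_ ?_ fun x => ?_)
  · exact (ha.norm.pow _).integrable_of_hasCompactSupport
      (.intro hK fun x hx => by simp [(hrest x hx).1, hpow_zero])
  · exact ((continuous_const.mul (hgrad.norm.pow 2)).add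
      (ha.norm.pow _)).integrable_of_hasCompactSupport (.intro hK fun x hx => by
        simp [norm_gradient_eq_norm_fderiv, (hrest x hx).1, (hrest x hx).2, hpow_zero])
  · exact le_add_of_nonneg_left (by positivity)

theorem hasDerivAt_integral_φ (h : IsC2Solution σ (Ico 0 T) a₀ φ₀ a φ) (hσ : 1 ≤ σ)
    (hK : IsCompact K) (haK : tsupport a₀ ⊆ K) (hφK : tsupport φ₀ ⊆ K) (ht : t ∈ Ioo 0 T) :
    HasDerivAt (fun s => ∫ x, φ s x)
      (-∫ x, (1 / 2 * ‖gradient (φ t) x‖ ^ 2 + ‖a t x‖ ^ (2 * σ))) t := by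
  have hcont : ContinuousOn (fun p : ℝ × EuclideanSpace ℝ (Fin n) =>
      -(1 / 2 * ‖gradient (φ p.1) p.2‖ ^ 2 + ‖a p.1 p.2‖ ^ (2 * σ))) (Ico 0 T ×ˢ univ) := by
    have hgrad := (contDiffOn_gradient_slice h.contDiffOn_φ).continuousOn
    have ha := h.contDiffOn_a.continuousOn
    fun_prop
  rw [← integral_neg]
  exact hasDerivAt_integral_of_compact_support isOpen_Ioo hK
    (fun s hs => (h.contDiff_φ (Ioo_subset_Ico_self hs)).continuous)
    (hcont.mono (prod_mono Ioo_subset_Ico_self subset_rfl))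
    (fun s hs x => (h.hasDerivWithinAt_φ (Ioo_subset_Ico_self hs) x).hasDerivAt
      (Ico_mem_nhds hs.1 hs.2))
    (fun s hs x hx => (h.eq_zero_of_notMem_tsupport hσ (notMem_subset haK hx)
      (notMem_subset hφK hx) (Ioo_subset_Ico_self hs)).2) ht

theorem integral_φ_le (h : IsC2Solution σ (Ico 0 T) a₀ φ₀ a φ) (hσ : 1 ≤ σ)
    (hK : IsCompact K) (hK₀ : volume K ≠ 0) (haK : tsupport a₀ ⊆ K) (hφK : tsupport φ₀ ⊆ K)
    (ht : t ∈ Ico 0 T) :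
    ∫ x, φ t x ≤ (∫ x, φ₀ x)
      - volume.real K * ((∫ x, ‖a₀ x‖ ^ 2) / volume.real K) ^ σ * t := by
  have hcont : ContinuousOn (fun s => ∫ x, φ s x) (Ico 0 T) :=
    continuousOn_integral_of_compact_support hK h.contDiffOn_φ.continuousOn fun s x hs hx =>
      (h.eq_zero_of_notMem_tsupport hσ (notMem_subset haK hx) (notMem_subset hφK hx) hs).2
  have hmem {s : ℝ} (hs : s ∈ interior (Icc 0 t)) : s ∈ Ioo 0 T := by
    rw [interior_Icc] at hs
    exact Ioo_subset_Ioo_right ht.2.le hs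
  have hderiv {s : ℝ} (hs : s ∈ interior (Icc 0 t)) :=
    h.hasDerivAt_integral_φ hσ hK haK hφK (hmem hs)
  have hmvt := (convex_Icc 0 t).image_sub_le_mul_sub_of_deriv_le
    (hcont.mono (Icc_subset_Ico_right ht.2))
    (fun s hs => (hderiv hs).differentiableAt.differentiableWithinAt)
    (fun s hs => (hderiv hs).deriv.trans_le (neg_le_neg
      (h.le_integral_kinetic_add_internal hσ hK hK₀ haK hφK (Ioo_subset_Ico_self (hmem hs)))))
    0 (left_mem_Icc.2 ht.1) t (right_mem_Icc.2 ht.1) ht.1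
  simp only [h.init_φ, sub_zero] at hmvt
  linarith

theorem le_integral_φ (h : IsC2Solution σ (Ico 0 T) a₀ φ₀ a φ) (hσ : 1 ≤ σ)
    (hK : IsCompact K) (haK : tsupport a₀ ⊆ K) (hφK : tsupport φ₀ ⊆ K)
    {y : EuclideanSpace ℝ (Fin n)} (hy : y ∉ K) {d : ℝ} (hd : ∀ x ∈ K, ‖y - x‖ ≤ d) (ht : 0 ≤ t)
    (htT : t + 1 < T) : -(volume.real K * (d ^ 2 / 2)) ≤ ∫ x, φ t x := by
  have htI : t ∈ Ico 0 T := ⟨ht, by linarith⟩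
  have hφy : φ (t + 1) y = 0 := (h.eq_zero_of_notMem_tsupport hσ (notMem_subset haK hy)
    (notMem_subset hφK hy) ⟨by linarith, htT⟩).2
  have hφ_ge (x) (hx : x ∈ K) : -(d ^ 2 / 2) ≤ φ t x := by
    have hHopfLax := h.φ_le_add_norm_sq_div ht (lt_add_one t) htT x y
    rw [hφy, add_sub_cancel_left, mul_one] at hHopfLax
    have hsq : ‖y - x‖ ^ 2 ≤ d ^ 2 := pow_le_pow_left₀ (norm_nonneg _) (hd x hx) 2
    linarith
  calc -(volume.real K * (d ^ 2 / 2)) = ∫ _ in K, -(d ^ 2 / 2) := by simp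
    _ ≤ ∫ x in K, φ t x := setIntegral_mono_on (integrableOn_const hK.measure_lt_top.ne)
        ((h.contDiff_φ htI).continuous.continuousOn.integrableOn_compact hK) hK.measurableSet hφ_ge
    _ = ∫ x, φ t x := setIntegral_eq_integral_of_forall_compl_eq_zero fun x hx =>
        (h.eq_zero_of_notMem_tsupport hσ (notMem_subset haK hx) (notMem_subset hφK hx) htI).2

theorem lifespan_le_of_mass_pos (h : IsC2Solution σ (Ico 0 T) a₀ φ₀ a φ) (hσ : 1 ≤ σ)
    (hK : IsCompact K) (hK₀ : volume K ≠ 0) (haK : tsupport a₀ ⊆ K) (hφK : tsupport φ₀ ⊆ K)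
    {y : EuclideanSpace ℝ (Fin n)} (hy : y ∉ K) {d : ℝ} (hd : ∀ x ∈ K, ‖y - x‖ ≤ d)
    (hmass : 0 < ∫ x, ‖a₀ x‖ ^ 2) :
    T ≤ 1 + max 0 (((∫ x, φ₀ x) + volume.real K * (d ^ 2 / 2))
      / (volume.real K * ((∫ x, ‖a₀ x‖ ^ 2) / volume.real K) ^ σ)) := by
  have hvol : 0 < volume.real K := ENNReal.toReal_pos hK₀ hK.measure_lt_top.ne
  by_contra! hT
  obtain ⟨t, hbt, htT⟩ := exists_between (lt_sub_iff_add_lt'.2 hT)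
  obtain ⟨ht, hlt⟩ := max_lt_iff.1 hbt
  rw [div_lt_iff₀ (by positivity)] at hlt
  have hupper := h.integral_φ_le hσ hK hK₀ haK hφK ⟨ht.le, by linarith⟩
  have hlower := h.le_integral_φ hσ hK haK hφK hy hd ht.le (lt_sub_iff_add_lt.1 htT)
  linarith

end Mass

theorem restrict_Ico (h : IsC2Solution σ (Ici 0) a₀ φ₀ a φ) (T : ℝ) :
    IsC2Solution σ (Ico 0 T) a₀ φ₀ a φ where
  contDiffOn_a := h.contDiffOn_a.mono (prod_mono Ico_subset_Ici_self subset_rfl)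
  contDiffOn_φ := h.contDiffOn_φ.mono (prod_mono Ico_subset_Ici_self subset_rfl)
  eikonal t ht x := by
    rw [← Ici_inter_Iio, derivWithin_inter (Iio_mem_nhds ht.2)]
    exact h.eikonal t ht.1 x
  transport t ht x := by
    rw [← Ici_inter_Iio, derivWithin_inter (Iio_mem_nhds ht.2)]
    exact h.transport t ht.1 x
  init_a := h.init_a
  init_φ := h.init_φ

end IsC2Solution

section Lifespan

variable {n σ : ℕ} {a₀ : EuclideanSpace ℝ (Fin n) → ℂ} {φ₀ : EuclideanSpace ℝ (Fin n) → ℝ}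

theorem exists_forall_lifespan_le_of_amplitude_ne_zero [NeZero n] (hσ : 1 ≤ σ)
    (ha₀ : Continuous a₀) (ha₀c : HasCompactSupport a₀) (hφ₀c : HasCompactSupport φ₀)
    (hne : a₀ ≠ 0) : ∃ T₀, ∀ T a φ, IsC2Solution σ (Ico 0 T) a₀ φ₀ a φ → T ≤ T₀ := by
  obtain ⟨K, hK, haK, hφK⟩ : ∃ K, IsCompact K ∧ tsupport a₀ ⊆ K ∧ tsupport φ₀ ⊆ K :=
    ⟨_, IsCompact.union ha₀c hφ₀c, subset_union_left, subset_union_right⟩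
  obtain ⟨z, hz⟩ := Function.ne_iff.1 hne
  have hK₀ : volume K ≠ 0 := ((ha₀.isOpen_support.measure_pos volume ⟨z, hz⟩).trans_le
    (measure_mono ((subset_tsupport a₀).trans haK))).ne'
  have := NormedSpace.noncompactSpace ℝ (EuclideanSpace ℝ (Fin n))
  obtain ⟨y, hy⟩ := (ne_univ_iff_exists_notMem _).1 hK.ne_univ
  obtain ⟨d, hd⟩ : ∃ d, ∀ x ∈ K, ‖y - x‖ ≤ d :=
    hK.exists_bound_of_continuousOn (by fun_prop)
  exact ⟨_, fun T a φ h => h.lifespan_le_of_mass_pos hσ hK hK₀ haK hφK hy hd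
    (integral_norm_sq_pos ha₀ ha₀c hne)⟩

theorem exists_forall_lifespan_le_of_phase_ne_zero [NeZero n] (hσ : 1 ≤ σ)
    (hφ₀ : Continuous φ₀) (hφ₀c : HasCompactSupport φ₀) (hne : φ₀ ≠ 0) :
    ∃ T₀, ∀ T a φ, IsC2Solution σ (Ico 0 T) 0 φ₀ a φ → T ≤ T₀ := by
  obtain ⟨x, hx, hDx⟩ := exists_ne_zero_fderiv_eq_zero hφ₀ hφ₀c hne
  have := NormedSpace.noncompactSpace ℝ (EuclideanSpace ℝ (Fin n))
  obtain ⟨y, hy⟩ := (ne_univ_iff_exists_notMem _).1 (IsCompact.ne_univ hφ₀c)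
  have hφ₀y : φ₀ y = 0 := image_eq_zero_of_notMem_tsupport hy
  exact ⟨_, fun T a φ h => h.lifespan_le_of_isVacuumAtRest hσ ⟨rfl, hDx⟩
    ⟨rfl, fderiv_of_notMem_tsupport ℝ hy⟩ (hφ₀y.symm ▸ hx)⟩

theorem exists_forall_lifespan_le [NeZero n] (hσ : 1 ≤ σ) (ha₀ : Continuous a₀)
    (hφ₀ : Continuous φ₀) (ha₀c : HasCompactSupport a₀) (hφ₀c : HasCompactSupport φ₀)
    (hne : a₀ ≠ 0 ∨ φ₀ ≠ 0) : ∃ T₀, ∀ T a φ, IsC2Solution σ (Ico 0 T) a₀ φ₀ a φ → T ≤ T₀ := by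
  rcases eq_or_ne a₀ 0 with rfl | ha
  · exact exists_forall_lifespan_le_of_phase_ne_zero hσ hφ₀ hφ₀c (hne.resolve_left (by simp))
  · exact exists_forall_lifespan_le_of_amplitude_ne_zero hσ ha₀ ha₀c hφ₀c ha

theorem sobolevLifespan_le_classicalLifespan :
    sobolevLifespan σ a₀ φ₀ ≤ classicalLifespan σ a₀ φ₀ :=
  iSup₂_le fun T ⟨hT, a, φ, h, _⟩ => le_iSup₂_of_le T ⟨hT, a, φ, h⟩ le_rfl

end Lifespan

theorem mainTheorem9 (n σ : ℕ) (hn : 1 ≤ n) (hσ : 1 ≤ σ)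
    (a₀ : EuclideanSpace ℝ (Fin n) → ℂ) (φ₀ : EuclideanSpace ℝ (Fin n) → ℝ)
    (ha₀ : ContDiff ℝ 2 a₀) (hφ₀ : ContDiff ℝ 2 φ₀)
    (ha₀c : HasCompactSupport a₀) (hφ₀c : HasCompactSupport φ₀)
    (hne : a₀ ≠ 0 ∨ φ₀ ≠ 0) :
    (¬ ∃ (a : ℝ → EuclideanSpace ℝ (Fin n) → ℂ) (φ : ℝ → EuclideanSpace ℝ (Fin n) → ℝ),
        IsC2Solution σ (Ici 0) a₀ φ₀ a φ) ∧
    classicalLifespan σ a₀ φ₀ < ⊤ ∧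
    (ContDiff ℝ ∞ a₀ → ContDiff ℝ ∞ φ₀ → sobolevLifespan σ a₀ φ₀ < ⊤) := by
  have : NeZero n := ⟨by omega⟩
  obtain ⟨T₀, hT₀⟩ := exists_forall_lifespan_le hσ ha₀.continuous hφ₀.continuous ha₀c hφ₀c hne
  have hlife : classicalLifespan σ a₀ φ₀ < ⊤ :=
    (iSup₂_le fun T ⟨_, a, φ, h⟩ => ENNReal.ofReal_le_ofReal (hT₀ T a φ h)).trans_lt
      (ENNReal.ofReal_lt_top (r := T₀))
  refine ⟨?_, hlife, fun _ _ => sobolevLifespan_le_classicalLifespan.trans_lt hlife⟩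
  rintro ⟨a, φ, h⟩
  exact (lt_add_one T₀).not_ge (hT₀ (T₀ + 1) a φ (h.restrict_Ico (T₀ + 1)))
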